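/- Let $n \ge 2$ be an integer and let $SD_{8n} = \langle a, b : a^{4n} = b^2 = e,\ ba = a^{2n-1}b \rangle$ be the semidihedral group of order $8n$. Let $\mathcal{P}_e(SD_{8n})$ be its enhanced power graph, that is, the simple graph with vertex set $SD_{8n}$ in which two distinct elements $x, y$ are adjacent if and only if $x, y \in \langle z \rangle$ for some $z \in SD_{8n}$. Then the number of spanning trees of $\mathcal{P}_e(SD_{8n})$ is $2^{11n-5} \cdot 3 \cdot n^{4n-2}$. -/

import Mathlib

/-- The defining relations `a ^ (4 n) = e`, `b ^ 2 = e`, `b a = a ^ (2 n - 1) b` of the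
semidihedral group, in the free group on `a = FreeGroup.of 0` and `b = FreeGroup.of 1`.
The natural-number subtraction `2 * n - 1` is the true one for `1 ≤ n`. -/
def semidihedralRels (n : ℕ) : Set (FreeGroup (Fin 2)) :=
  {FreeGroup.of 0 ^ (4 * n),
   FreeGroup.of 1 ^ 2,
   (FreeGroup.of 1 * FreeGroup.of 0) * (FreeGroup.of 0 ^ (2 * n - 1) * FreeGroup.of 1)⁻¹}

/-- The semidihedral group `SD_{8n} = ⟨a, b : a ^ (4 n) = b ^ 2 = e, b a = a ^ (2 n - 1) b⟩`. -/
abbrev SemidihedralGroup (n : ℕ) : Type := PresentedGroup (semidihedralRels n)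

/-- The enhanced power graph of a group `G`: two distinct elements are adjacent when they both lie in
the cyclic subgroup `⟨z⟩` for some `z` in `G`. -/
def enhancedPowerGraph (G : Type*) [Group G] : SimpleGraph G where
  Adj x y := x ≠ y ∧ ∃ z : G, x ∈ Subgroup.zpowers z ∧ y ∈ Subgroup.zpowers z
  symm := ⟨fun _ _ h => ⟨h.1.symm, h.2.imp fun _ hH => ⟨hH.2, hH.1⟩⟩⟩
  loopless := ⟨fun _ h => h.1 rfl⟩

/-- The set of spanning trees of a graph `Γ`. A spanning tree is a tree on the whole vertex set
of `Γ`, all of whose edges are edges of `Γ`. -/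
def spanningTrees {V : Type*} (Γ : SimpleGraph V) : Set (SimpleGraph V) :=
  {T | T ≤ Γ ∧ T.IsTree}

/-! The matrix-tree theorem reduces the count to a determinant. Spanning trees correspond to
well-founded parent functions; expanding the reduced Laplacian multilinearly along rows gives one
determinant per parent function, equal to 1 if it is well-founded and 0 otherwise
(`ncard_spanningTrees_eq_det`).

Every cyclic subgroup lies in `⟨a⟩`, in one of the `n` subgroups of order 4 generated by `a ^ i b`
with `i` odd, all containing `a ^ (2 n)`, or in one of the `2 n` subgroups of order 2 generated by
`a ^ i b` with `i` even. So the graph is a `4 n`-clique, `n` pairs joined to the hubs `e` and `a ^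
(2 n)`, and `2 n` leaves at `e` (`SemidihedralGroup.isTwoHubGraph`). A Schur complement eliminates
pairs and leaves, and what remains is a diagonal matrix minus the all-ones matrix
(`IsTwoHubGraph.det_reducedLaplacian`). -/

/-! ### Spanning trees as parent functions -/

/-- The relation "`x` is the parent of `y`" for a parent function `f` on the non-root vertices. -/
def IsParent {W : Type*} (f : W → Option W) (x y : Option W) : Prop :=
  ∃ v, y = some v ∧ x = f v

/-- The graph joining each non-root vertex to its parent. -/
def parentGraph {W : Type*} (f : W → Option W) : SimpleGraph (Option W) :=
  SimpleGraph.fromEdgeSet (Set.range fun v => s(some v, f v))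

theorem acc_isParent_some {W : Type*} (f : W → Option W) (v : W) :
    Acc (IsParent f) (some v) ↔ Acc (IsParent f) (f v) := by
  refine ⟨fun h => h.inv ⟨v, rfl, rfl⟩, fun h => Acc.intro _ ?_⟩
  rintro y ⟨w, hw, rfl⟩
  rwa [← Option.some_injective _ hw]

theorem acc_isParent_none {W : Type*} (f : W → Option W) : Acc (IsParent f) none := by
  refine Acc.intro _ ?_
  rintro y ⟨w, hw, -⟩
  cases hw

theorem parentGraph_adj {W : Type*} {f : W → Option W} (hf : WellFounded (IsParent f)) (v : W) :
    (parentGraph f).Adj (some v) (f v) := by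
  refine (SimpleGraph.fromEdgeSet_adj _).2 ⟨⟨v, rfl⟩, fun h => ?_⟩
  exact hf.irrefl.irrefl (some v) ⟨v, rfl, h⟩

theorem parentGraph_connected {W : Type*} {f : W → Option W} (hf : WellFounded (IsParent f)) :
    (parentGraph f).Connected := by
  have key : ∀ x, (parentGraph f).Reachable x none := by
    intro x
    induction x using hf.induction with
    | _ x ih =>
      cases x with
      | none => exact SimpleGraph.Reachable.refl _
      | some v => exact (parentGraph_adj hf v).reachable.trans (ih _ ⟨v, rfl, rfl⟩)
  exact (SimpleGraph.connected_iff_exists_forall_reachable _).2 ⟨none, fun x => (key x).symm⟩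

theorem parentGraph_isTree {W : Type*} [Finite W] {f : W → Option W}
    (hf : WellFounded (IsParent f)) : (parentGraph f).IsTree := by
  have hc := parentGraph_connected hf
  refine SimpleGraph.isTree_iff_connected_and_card.2 ⟨hc, le_antisymm ?_ ?_⟩
  · rw [Finite.card_option]
    have h : (parentGraph f).edgeSet ⊆ Set.range fun v => s(some v, f v) := by
      rw [parentGraph, SimpleGraph.edgeSet_fromEdgeSet]
      exact Set.sdiff_subset
    have h1 := Nat.card_mono (Set.finite_range _) h
    have h2 := Finite.card_range_le fun v => s(some v, f v)
    omega
  · exact hc.card_vert_le_card_edgeSet_add_one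

/-- By induction from the root: if an edge `v`–`f v` were oriented the other way by `g`, the
induction hypothesis at `f v` would give a 2-cycle of `f`. -/
theorem parentGraph_injective {W : Type*} {f g : W → Option W} (hf : WellFounded (IsParent f))
    (h : parentGraph f = parentGraph g) : f = g := by
  have key : ∀ x v, x = some v → f v = g v := by
    intro x
    induction x using hf.induction with
    | _ x ih =>
      rintro v rfl
      have h1 := parentGraph_adj hf v
      rw [h] at h1
      obtain ⟨⟨u, hu⟩, -⟩ := (SimpleGraph.fromEdgeSet_adj _).1 h1
      rcases Sym2.eq_iff.1 hu with ⟨hu1, hu2⟩ | ⟨hu1, hu2⟩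
      · rw [← hu2, Option.some_injective _ hu1]
      · have h3 := ih (f v) ⟨v, rfl, rfl⟩ u hu1.symm
        exact (hf.asymmetric (a := some v) (b := f v) ⟨u, hu1.symm, by rw [h3, hu2]⟩
          ⟨v, rfl, rfl⟩).elim
  exact funext fun v => key _ v rfl

theorem parentGraph_le {W : Type*} {f : W → Option W} {G : SimpleGraph (Option W)}
    (h : ∀ v, G.Adj (some v) (f v)) : parentGraph f ≤ G := by
  intro x y hxy
  obtain ⟨⟨u, hu⟩, -⟩ := (SimpleGraph.fromEdgeSet_adj _).1 hxy
  rcases Sym2.eq_iff.1 hu with ⟨rfl, rfl⟩ | ⟨rfl, rfl⟩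
  · exact h u
  · exact (h u).symm

/-- The parent is a neighbour closer to the root. The resulting subgraph is connected, so it is all
of `T`, trees being minimal connected graphs. -/
theorem exists_parentGraph_eq {W : Type*} {T : SimpleGraph (Option W)} (hT : T.IsTree) :
    ∃ f : W → Option W, WellFounded (IsParent f) ∧ parentGraph f = T := by
  have step : ∀ v : W, ∃ y, T.Adj (some v) y ∧ T.dist y none < T.dist (some v) none := by
    intro v
    obtain ⟨p, hp⟩ := hT.connected.exists_walk_length_eq_dist (some v) none
    cases p with
    | cons ha q =>
      refine ⟨_, ha, ?_⟩
      have := SimpleGraph.dist_le q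
      rw [SimpleGraph.Walk.length_cons] at hp
      omega
  choose f hf hd using step
  have hwf : WellFounded (IsParent f) := by
    refine Subrelation.wf (r := InvImage (· < ·) fun x => T.dist x none) ?_
      (InvImage.wf _ wellFounded_lt)
    rintro x y ⟨v, rfl, rfl⟩
    exact hd v
  refine ⟨f, hwf, le_antisymm (parentGraph_le hf) ?_⟩
  exact (SimpleGraph.isTree_iff_minimal_connected.1 hT).2 (parentGraph_connected hwf)
    (parentGraph_le hf)

theorem ncard_spanningTrees_eq {W : Type*} [Finite W] (G : SimpleGraph (Option W)) :
    (spanningTrees G).ncard =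
      {f : W → Option W | (∀ v, G.Adj (some v) (f v)) ∧ WellFounded (IsParent f)}.ncard := by
  rw [← Set.InjOn.ncard_image (f := parentGraph) fun f hf g _ h => parentGraph_injective hf.2 h]
  congr 1
  ext T
  constructor
  · rintro ⟨hle, hT⟩
    obtain ⟨f, hf, rfl⟩ := exists_parentGraph_eq hT
    exact ⟨f, ⟨fun v => hle (parentGraph_adj hf v), hf⟩, rfl⟩
  · rintro ⟨f, ⟨hf, hwf⟩, rfl⟩
    exact ⟨parentGraph_le hf, parentGraph_isTree hwf⟩

/-! ### The matrix-tree theorem -/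

/-- The column vector indexed by the non-root vertices attached to a vertex: zero at the root, and
the indicator of the vertex elsewhere. -/
def vertexVec {W : Type*} [DecidableEq W] (x : Option W) (w : W) : ℚ := if x = some w then 1 else 0

/-- Parents have smaller rank, so the transpose is block triangular by rank, with identity diagonal
blocks. -/
theorem det_parent_eq_one {W : Type*} [Fintype W] [DecidableEq W] {f : W → Option W}
    (hf : WellFounded (IsParent f)) :
    (Matrix.of fun v w => vertexVec (some v) w - vertexVec (f v) w).det = 1 := by
  rw [← Matrix.det_transpose]
  have : IsWellFounded (Option W) (IsParent f) := ⟨hf⟩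
  have hlt : ∀ v w, f v = some w →
      IsWellFounded.rank (IsParent f) (some w) < IsWellFounded.rank (IsParent f) (some v) :=
    fun v w h => IsWellFounded.rank_lt_of_rel ⟨v, rfl, h.symm⟩
  rw [Matrix.BlockTriangular.det (b := fun v => IsWellFounded.rank (IsParent f) (some v))]
  · refine Finset.prod_eq_one fun a _ => ?_
    refine Eq.trans (congrArg Matrix.det ?_) Matrix.det_one
    ext ⟨v, hv⟩ ⟨w, hw⟩
    have h1 : f w ≠ some v := fun h => (hlt _ _ h).ne (hv.trans hw.symm)
    simp [Matrix.toSquareBlock_def, vertexVec, h1, Matrix.one_apply, eq_comm]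
  · intro v w h
    have h1 : f w ≠ some v := fun h' => (hlt _ _ h').not_gt h
    have h2 : w ≠ v := by rintro rfl; exact lt_irrefl _ h
    simp [vertexVec, h1, h2]

/-- The indicator of the inaccessible vertices is a nonzero kernel vector, since `v` is accessible
exactly when `f v` is. -/
theorem det_parent_eq_zero {W : Type*} [Fintype W] [DecidableEq W] {f : W → Option W}
    (hf : ¬ WellFounded (IsParent f)) :
    (Matrix.of fun v w => vertexVec (some v) w - vertexVec (f v) w).det = 0 := by
  classical
  have hsum : ∀ x : Option W,
      ∑ w, vertexVec x w * (if Acc (IsParent f) (some w) then 0 else 1) =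
        if Acc (IsParent f) x then 0 else 1 := by
    intro x
    cases x with
    | none => simp [vertexVec, acc_isParent_none]
    | some v => simp only [vertexVec, Option.some_inj, ite_mul, one_mul, zero_mul,
        Finset.sum_ite_eq, Finset.mem_univ, if_true]
  rw [← Matrix.exists_mulVec_eq_zero_iff]
  refine ⟨fun v => if Acc (IsParent f) (some v) then 0 else 1, fun h => hf ⟨fun x => ?_⟩, ?_⟩
  · cases x with
    | none => exact acc_isParent_none f
    | some v => simpa using congrFun h v
  · ext v
    simp only [Matrix.mulVec, dotProduct, Matrix.of_apply, sub_mul, Finset.sum_sub_distrib, hsum,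
      acc_isParent_some f v, sub_self, Pi.zero_apply]

/-- The Laplacian matrix of a graph with the row and the column of the root removed. -/
def reducedLaplacian {W : Type*} [Fintype W] [DecidableEq W] (G : SimpleGraph (Option W))
    [DecidableRel G.Adj] : Matrix W W ℚ :=
  Matrix.of fun v w =>
    (if v = w then (G.degree (some v) : ℚ) else 0) - if G.Adj (some v) (some w) then 1 else 0

theorem ncard_spanningTrees_eq_det {W : Type*} [Fintype W] [DecidableEq W]
    (G : SimpleGraph (Option W)) [DecidableRel G.Adj] :
    ((spanningTrees G).ncard : ℚ) = (reducedLaplacian G).det := by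
  classical
  have hrow : reducedLaplacian G = Matrix.of fun v =>
      ∑ x ∈ G.neighborFinset (some v), (vertexVec (some v) - vertexVec x : W → ℚ) := by
    ext v w
    simp [reducedLaplacian, vertexVec, Finset.sum_apply]
  have hexp := (Matrix.detRowAlternating (n := W) (R := ℚ)).toMultilinearMap.map_sum_finset
    (fun v x => (vertexVec (some v) - vertexVec x : W → ℚ)) fun v => G.neighborFinset (some v)
  rw [hrow]
  refine Eq.trans ?_ hexp.symm
  have hterm : ∀ f : W → Option W,
      (Matrix.detRowAlternating (n := W) (R := ℚ)).toMultilinearMap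
        (fun v => (vertexVec (some v) - vertexVec (f v) : W → ℚ)) =
          if WellFounded (IsParent f) then 1 else 0 := by
    intro f
    split_ifs with h
    · exact det_parent_eq_one h
    · exact det_parent_eq_zero h
  simp_rw [hterm]
  rw [ncard_spanningTrees_eq, Finset.sum_boole, ← Set.ncard_coe_finset]
  congr 2
  ext f
  simp [Fintype.mem_piFinset]

theorem ncard_spanningTrees_comap {V V' : Type*} (e : V ≃ V') (G : SimpleGraph V') :
    (spanningTrees (G.comap e)).ncard = (spanningTrees G).ncard := by
  have h : spanningTrees (G.comap e) = e.symm.simpleGraph '' spanningTrees G := by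
    ext T
    refine ⟨fun ⟨hle, hT⟩ => ⟨e.simpleGraph T, ⟨fun x y hxy => ?_, ?_⟩, ?_⟩, ?_⟩
    · simpa using hle hxy
    · exact (SimpleGraph.Iso.comap e.symm T).isTree_iff.2 hT
    · exact e.simpleGraph.symm_apply_apply T
    · rintro ⟨T, ⟨hle, hT⟩, rfl⟩
      exact ⟨fun x y hxy => hle hxy, (SimpleGraph.Iso.comap e T).isTree_iff.2 hT⟩
  rw [h, Set.ncard_image_of_injective _ (Equiv.injective _)]

/-! ### The determinant of a two-hub graph -/

theorem det_diagonal_sub_one {ι : Type*} [Fintype ι] [DecidableEq ι] (d : ι → ℚ)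
    (hd : ∀ i, d i ≠ 0) :
    (Matrix.diagonal d - Matrix.of fun _ _ => 1).det = (∏ i, d i) * (1 - ∑ i, (d i)⁻¹) := by
  have h : Matrix.diagonal d - (Matrix.of fun _ _ => 1) =
      Matrix.diagonal d * (1 + Matrix.replicateCol Unit (fun i => -(d i)⁻¹) *
        Matrix.replicateRow Unit fun _ => (1 : ℚ)) := by
    ext i j
    rw [Matrix.diagonal_mul]
    by_cases hij : i = j <;> simp [hij, Matrix.mul_apply, hd, mul_add, sub_eq_add_neg]
  rw [h, Matrix.det_mul, Matrix.det_diagonal, Matrix.det_one_add_replicateCol_mul_replicateRow]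
  simp [dotProduct, sub_eq_add_neg]

/-- A Schur complement in which `X` plays the role of `-D⁻¹ Q'`, so that `D` need not be inverted.
-/
theorem det_fromBlocks_of_add_mul_eq_zero {m k R : Type*} [Fintype m] [DecidableEq m] [Fintype k]
    [DecidableEq k] [CommRing R] (P : Matrix m m R) (Q : Matrix m k R) (Q' : Matrix k m R)
    (D : Matrix k k R) (X : Matrix k m R) (h : Q' + D * X = 0) :
    (Matrix.fromBlocks P Q Q' D).det = (P + Q * X).det * D.det := by
  have h1 : Matrix.fromBlocks P Q Q' D * Matrix.fromBlocks 1 0 X 1 =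
      Matrix.fromBlocks (P + Q * X) Q 0 D := by
    rw [Matrix.fromBlocks_multiply]
    simp [h]
  have h2 := congrArg Matrix.det h1
  rwa [Matrix.det_mul, Matrix.det_fromBlocks_zero₁₂, Matrix.det_fromBlocks_zero₂₁, Matrix.det_one,
    Matrix.det_one, mul_one, mul_one] at h2

/-- The graph on a root `none`, a second hub `some (inl none)`, a set `A` forming a clique with the
two hubs, pairs indexed by `B` each of which forms a clique with the two hubs, and a set `C` of
leaves at the root. -/
structure IsTwoHubGraph {A B C : Type*}
    (G : SimpleGraph (Option (Option A ⊕ (Fin 2 × B ⊕ C)))) : Prop where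
  root : ∀ w, G.Adj (some w) none
  clique : ∀ x y, G.Adj (some (.inl x)) (some (.inl y)) ↔ x ≠ y
  hub : ∀ x p, G.Adj (some (.inl x)) (some (.inr (.inl p))) ↔ x = none
  pair : ∀ p q, G.Adj (some (.inr (.inl p))) (some (.inr (.inl q))) ↔ p.2 = q.2 ∧ p.1 ≠ q.1
  clique_leaf : ∀ x c, ¬ G.Adj (some (.inl x)) (some (.inr (.inr c)))
  pair_leaf : ∀ p c, ¬ G.Adj (some (.inr (.inl p))) (some (.inr (.inr c)))
  leaf_leaf : ∀ c d, ¬ G.Adj (some (.inr (.inr c))) (some (.inr (.inr d)))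

namespace IsTwoHubGraph

variable {A B C : Type*} {G : SimpleGraph (Option (Option A ⊕ (Fin 2 × B ⊕ C)))}

theorem hub_symm (hG : IsTwoHubGraph G) (x : Option A) (p : Fin 2 × B) :
    G.Adj (some (.inr (.inl p))) (some (.inl x)) ↔ x = none := by
  rw [G.adj_comm, hG.hub]

theorem leaf_clique (hG : IsTwoHubGraph G) (x : Option A) (c : C) :
    ¬ G.Adj (some (.inr (.inr c))) (some (.inl x)) := by
  rw [G.adj_comm]; exact hG.clique_leaf x c

theorem leaf_pair (hG : IsTwoHubGraph G) (p : Fin 2 × B) (c : C) :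
    ¬ G.Adj (some (.inr (.inr c))) (some (.inr (.inl p))) := by
  rw [G.adj_comm]; exact hG.pair_leaf p c

variable [Fintype A] [Fintype B] [Fintype C] [DecidableRel G.Adj]

theorem degree_eq_sum (hG : IsTwoHubGraph G) (v : Option A ⊕ (Fin 2 × B ⊕ C)) :
    G.degree (some v) = 1 + ∑ w, if G.Adj (some v) (some w) then 1 else 0 := by
  rw [← G.card_neighborFinset_eq_degree, SimpleGraph.neighborFinset_eq_filter,
    Finset.card_filter, Fintype.sum_option, if_pos (hG.root v)]

theorem degree_clique [DecidableEq A] (hG : IsTwoHubGraph G) (x : A) :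
    G.degree (some (.inl (some x))) = Fintype.card A + 1 := by
  rw [hG.degree_eq_sum]
  simp only [Fintype.sum_sum_type, hG.clique, hG.hub, hG.clique_leaf, ne_eq, ite_not]
  simp [Finset.sum_ite, Finset.filter_ne, add_comm]

theorem degree_hub (hG : IsTwoHubGraph G) :
    G.degree (some (.inl none)) = Fintype.card A + 1 + 2 * Fintype.card B := by
  rw [hG.degree_eq_sum]
  simp only [Fintype.sum_sum_type, hG.clique, hG.hub, hG.clique_leaf]
  simp [Fintype.sum_option]
  omega

theorem degree_pair [DecidableEq B] (hG : IsTwoHubGraph G) (p : Fin 2 × B) :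
    G.degree (some (.inr (.inl p))) = 3 := by
  rw [hG.degree_eq_sum]
  simp only [Fintype.sum_sum_type, hG.hub_symm, hG.pair, hG.pair_leaf]
  obtain ⟨s, k⟩ := p
  have h : ∀ q : Fin 2 × B, (if k = q.2 ∧ s ≠ q.1 then 1 else 0) =
      (if q = (1 - s, k) then 1 else 0 : ℕ) := by
    rintro ⟨t, l⟩
    congr 1
    fin_cases s <;> fin_cases t <;> simp [eq_comm]
  have h' : ({x : Option A | x = none} : Finset (Option A)).card = 1 :=
    Finset.card_eq_one.2 ⟨none, by ext; simp⟩
  simp [h, h']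

theorem degree_leaf (hG : IsTwoHubGraph G) (c : C) : G.degree (some (.inr (.inr c))) = 1 := by
  rw [hG.degree_eq_sum]
  simp [hG.leaf_clique, hG.leaf_pair, hG.leaf_leaf]

theorem det_reducedLaplacian [DecidableEq A] [DecidableEq B] [DecidableEq C]
    (hG : IsTwoHubGraph G) :
    (reducedLaplacian G).det * (Fintype.card A + 2) =
      8 ^ Fintype.card B * (Fintype.card A + 2) ^ Fintype.card A *
        (Fintype.card A + 2 + 2 * Fintype.card B) := by
  set Q : Matrix (Option A) (Fin 2 × B ⊕ C) ℚ :=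
    .of fun x p => if x = none ∧ p.isLeft then -1 else 0 with hQ
  -- The entry 1/2 comes from `!![3, -1; -1, 3]` sending `(1/2, 1/2)` to `(1, 1)`.
  set X : Matrix (Fin 2 × B ⊕ C) (Option A) ℚ :=
    .of fun p x => if x = none ∧ p.isLeft then 1 / 2 else 0 with hX
  set D : Matrix (Fin 2 × B ⊕ C) (Fin 2 × B ⊕ C) ℚ :=
    .fromBlocks (.blockDiagonal fun _ => !![3, -1; -1, 3]) 0 0 1 with hD
  set P : Matrix (Option A) (Option A) ℚ := .diagonal (fun x => (Fintype.card A : ℚ) + 2 +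
    if x = none then 2 * (Fintype.card B : ℚ) else 0) - .of fun _ _ => 1 with hP
  have hL : reducedLaplacian G = .fromBlocks P Q Q.transpose D := by
    ext v w
    rcases v with (_ | x) | p | c <;> rcases w with (_ | y) | q | d <;>
      simp [reducedLaplacian, hP, hQ, hD, hG.clique, hG.hub, hG.pair, hG.clique_leaf,
        hG.pair_leaf, hG.leaf_leaf, hG.hub_symm, hG.leaf_clique, hG.leaf_pair, hG.degree_clique,
        hG.degree_hub, hG.degree_pair, hG.degree_leaf, Matrix.one_apply, Matrix.diagonal_apply]
    · ring
    · split_ifs <;> ring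
    · obtain ⟨s, k⟩ := p
      obtain ⟨t, l⟩ := q
      rw [Matrix.blockDiagonal_apply]
      fin_cases s <;> fin_cases t <;> by_cases hkl : k = l <;> simp [hkl]
  have hDX : Q.transpose + D * X = 0 := by
    ext v x
    rcases v with ⟨s, k⟩ | c <;> rcases x with _ | x
    · fin_cases s <;>
        simp [hQ, hX, hD, Matrix.mul_apply, Fintype.sum_prod_type, Matrix.blockDiagonal_apply] <;>
        norm_num
    all_goals simp [hQ, hX, hD, Matrix.mul_apply]
  -- Each pair lowers the hub's diagonal entry by `2 * (1/2) = 1`.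
  have hPQ : P + Q * X = .diagonal (fun x => (Fintype.card A : ℚ) + 2 +
      if x = none then (Fintype.card B : ℚ) else 0) - .of fun _ _ => 1 := by
    ext x y
    rcases x with _ | x <;> rcases y with _ | y
    all_goals simp [hP, hQ, hX, Matrix.mul_apply, Matrix.diagonal_apply]
    ring
  have hDdet : D.det = 8 ^ Fintype.card B := by
    rw [hD, Matrix.det_fromBlocks_zero₂₁, Matrix.det_blockDiagonal]
    simp [Matrix.det_fin_two_of]
    norm_num
  have ha : (Fintype.card A : ℚ) + 2 ≠ 0 := by positivity
  have hab : (Fintype.card A : ℚ) + 2 + Fintype.card B ≠ 0 := by positivity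
  rw [hL, det_fromBlocks_of_add_mul_eq_zero _ _ _ _ X hDX, hPQ, hDdet, det_diagonal_sub_one]
  · simp [Fintype.prod_option, Fintype.sum_option]
    field_simp
    ring
  · intro x
    split_ifs
    · exact hab
    · simpa using ha

end IsTwoHubGraph

/-! ### Normal forms in the semidihedral group -/

namespace SemidihedralGroup

variable {n : ℕ}

/-- The generator `a`. -/
def a (n : ℕ) : SemidihedralGroup n := PresentedGroup.of 0

/-- The generator `b`. -/
def b (n : ℕ) : SemidihedralGroup n := PresentedGroup.of 1

theorem a_pow : a n ^ (4 * n) = 1 :=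
  PresentedGroup.one_of_mem (rels := semidihedralRels n) (Or.inl rfl)

theorem b_sq : b n ^ 2 = 1 :=
  PresentedGroup.one_of_mem (rels := semidihedralRels n) (Or.inr (Or.inl rfl))

theorem b_mul_a : b n * a n = a n ^ (2 * n - 1) * b n :=
  PresentedGroup.mk_eq_mk_of_mul_inv_mem (rels := semidihedralRels n) (Or.inr (Or.inr rfl))

theorem b_mul_a_pow (i : ℕ) : b n * a n ^ i = a n ^ ((2 * n - 1) * i) * b n := by
  rw [pow_mul]
  exact (show SemiconjBy (b n) (a n) _ from b_mul_a).pow_right i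

theorem a_pow_add (i : ℕ) : a n ^ (i + 4 * n) = a n ^ i := by
  rw [pow_add, a_pow, mul_one]

theorem a_pow_add_mul (i k : ℕ) : a n ^ (i + 4 * n * k) = a n ^ i := by
  rw [pow_add, pow_mul, a_pow, one_pow, mul_one]

theorem a_pow_mod (i : ℕ) : a n ^ (i % (4 * n)) = a n ^ i :=
  (pow_eq_pow_mod i a_pow).symm

/-- The action of `SD_{8n}` on `ℤ/4n` in which `a` is a translation and `b` a dilation. -/
theorem exists_hom (hn : 2 ≤ n) : ∃ f : SemidihedralGroup n →* Equiv.Perm (ZMod (4 * n)),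
    (∀ x, f (a n) x = x + 1) ∧ ∀ x, f (b n) x = (2 * n - 1) * x := by
  have h4 : (4 * n : ZMod (4 * n)) = 0 := by exact_mod_cast ZMod.natCast_self (4 * n)
  have hinv : Function.Involutive fun x : ZMod (4 * n) => (2 * n - 1) * x := by
    intro x
    -- `(2n - 1)² - 1 = 4n(n - 1)`.
    linear_combination (n - 1) * x * h4
  set α : Equiv.Perm (ZMod (4 * n)) := Equiv.addRight 1
  set β : Equiv.Perm (ZMod (4 * n)) := hinv.toPerm
  have hα : ∀ (i : ℕ) x, (α ^ i) x = x + i := by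
    intro i
    induction i with
    | zero => simp
    | succ i ih => intro x; rw [pow_succ', Equiv.Perm.mul_apply, ih]; simp [α, add_assoc]
  have hβ : ∀ x, β x = (2 * n - 1) * x := fun x => rfl
  have hrel : ∀ r ∈ semidihedralRels n, FreeGroup.lift ![α, β] r = 1 := by
    rintro r (rfl | rfl | rfl)
    · ext x
      simp [hα]
    · rw [map_pow]
      ext x
      simp [pow_two, β, hinv x]
    · rw [map_mul, map_inv, mul_inv_eq_one]
      ext x
      simp only [map_mul, map_pow, FreeGroup.lift_apply_of, Matrix.cons_val_one,
        Matrix.cons_val_zero, Matrix.cons_val_fin_one, Equiv.Perm.mul_apply, hα, hβ]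
      rw [Nat.cast_sub (by omega)]
      simp [α]
      ring
  exact ⟨PresentedGroup.toGroup hrel, fun x => by simp [a, α], fun x => by simp [b, hβ]⟩

/-- In the action on `ℤ/4n`, the image of 0 determines `i`, and then the image of 1 determines `s`.
-/
theorem exponents_eq (hn : 2 ≤ n) {i j s t : ℕ} (hi : i < 4 * n) (hj : j < 4 * n) (hs : s < 2)
    (ht : t < 2) (h : a n ^ i * b n ^ s = a n ^ j * b n ^ t) : i = j ∧ s = t := by
  obtain ⟨f, ha, hb⟩ := exists_hom hn
  have hα : ∀ (i : ℕ) x, (f (a n) ^ i) x = x + i := by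
    intro i
    induction i with
    | zero => simp
    | succ i ih => intro x; rw [pow_succ', Equiv.Perm.mul_apply, ih]; simp [ha, add_assoc]
  have hβ : ∀ (s : ℕ) x, (f (b n) ^ s) x = (2 * n - 1) ^ s * x := by
    intro s
    induction s with
    | zero => simp
    | succ i ih => intro x; rw [pow_succ', Equiv.Perm.mul_apply, ih]; rw [hb]; ring
  have hf : ∀ x : ZMod (4 * n), (2 * n - 1) ^ s * x + i = (2 * n - 1) ^ t * x + j := by
    intro x
    simpa [hα, hβ] using congrArg (fun g => f g x) h
  have h0 : (i : ZMod (4 * n)) = j := by simpa using hf 0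
  have hij : i = j := Nat.ModEq.eq_of_lt_of_lt ((ZMod.natCast_eq_natCast_iff _ _ _).1 h0) hi hj
  refine ⟨hij, ?_⟩
  -- This fails for `n = 1`, where the dilation is trivial.
  have h1 : ((2 * n - 1 : ℕ) : ZMod (4 * n)) ≠ ((1 : ℕ) : ZMod (4 * n)) := fun h => by
    have := Nat.ModEq.eq_of_lt_of_lt ((ZMod.natCast_eq_natCast_iff _ _ _).1 h) (by omega)
      (by omega)
    omega
  rw [Nat.cast_sub (by omega)] at h1
  push_cast at h1
  have h2 := hf 1
  rw [h0] at h2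
  simp only [mul_one, add_left_inj] at h2
  interval_cases s <;> interval_cases t
  · rfl
  · exact absurd (by simpa using h2.symm) h1
  · exact absurd (by simpa using h2) h1
  · rfl

theorem exists_eq (hn : 2 ≤ n) (x : SemidihedralGroup n) :
    ∃ i < 4 * n, ∃ s < 2, x = a n ^ i * b n ^ s := by
  suffices h : ∃ i s, x = a n ^ i * b n ^ s by
    obtain ⟨i, s, rfl⟩ := h
    refine ⟨i % (4 * n), Nat.mod_lt _ (by omega), s % 2, Nat.mod_lt _ (by omega), ?_⟩
    rw [a_pow_mod, ← pow_eq_pow_mod s b_sq]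
  have ha : ∀ (k i s : ℕ), ∃ j t, a n ^ k * (a n ^ i * b n ^ s) = a n ^ j * b n ^ t :=
    fun k i s => ⟨k + i, s, by rw [pow_add, mul_assoc]⟩
  have hb : ∀ i s : ℕ, ∃ j t, b n * (a n ^ i * b n ^ s) = a n ^ j * b n ^ t :=
    fun i s => ⟨(2 * n - 1) * i, s + 1, by rw [← mul_assoc, b_mul_a_pow, mul_assoc, pow_succ']⟩
  have ha_inv : (a n)⁻¹ = a n ^ (4 * n - 1) := by
    rw [inv_eq_iff_mul_eq_one, ← pow_succ', Nat.sub_add_cancel (by omega), a_pow]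
  have hb_inv : (b n)⁻¹ = b n := by rw [inv_eq_iff_mul_eq_one, ← pow_two, b_sq]
  have hx : x ∈ Subgroup.closure (Set.range (PresentedGroup.of (rels := semidihedralRels n))) := by
    rw [PresentedGroup.closure_range_of]; trivial
  induction hx using Subgroup.closure_induction_left with
  | one => exact ⟨0, 0, by simp⟩
  | mul_left g hg y _ ih =>
    obtain ⟨i, s, rfl⟩ := ih
    obtain ⟨c, rfl⟩ := hg
    fin_cases c
    · have h := ha 1 i s
      rwa [pow_one] at h
    · exact hb i s
  | inv_mul_cancel g hg y _ ih =>
    obtain ⟨i, s, rfl⟩ := ih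
    obtain ⟨c, rfl⟩ := hg
    fin_cases c
    · change ∃ j t, (a n)⁻¹ * _ = _
      rw [ha_inv]
      exact ha _ i s
    · change ∃ j t, (b n)⁻¹ * _ = _
      rw [hb_inv]
      exact hb i s

/-! ### Elements as vertices, and their cyclic subgroups -/

/-- The vertices of the enhanced power graph: the identity, the central involution `a ^ (2 n)`, the
other powers of `a`, the elements `a ^ i b` with `i` odd, and those with `i` even. -/
abbrev Vertex (n : ℕ) : Type :=
  Option (Option (Fin 2 × Fin (2 * n - 1)) ⊕ (Fin 2 × Fin n ⊕ Fin (2 * n)))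

/-- The exponents of `a` and `b` in the element corresponding to a vertex. -/
def exponents (n : ℕ) : Vertex n → ℕ × ℕ
  | none => (0, 0)
  | some (.inl none) => (2 * n, 0)
  | some (.inl (some (s, k))) => (k + 1 + (if s = 0 then 0 else 2 * n), 0)
  | some (.inr (.inl (s, k))) => (2 * k + 1 + (if s = 0 then 0 else 2 * n), 1)
  | some (.inr (.inr k)) => (2 * k, 1)

/-- The element corresponding to a vertex. -/
def ofVertex (n : ℕ) (x : Vertex n) : SemidihedralGroup n :=
  a n ^ (exponents n x).1 * b n ^ (exponents n x).2

theorem exponents_fst_lt (hn : 2 ≤ n) (x : Vertex n) : (exponents n x).1 < 4 * n := by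
  rcases x with _ | (_ | ⟨s, k⟩) | ⟨s, k⟩ | k <;> simp only [exponents] <;> (try split_ifs) <;>
    omega

theorem exponents_snd_lt (x : Vertex n) : (exponents n x).2 < 2 := by
  rcases x with _ | (_ | ⟨s, k⟩) | ⟨s, k⟩ | k <;> simp [exponents]

theorem exponents_injective (hn : 2 ≤ n) : Function.Injective (exponents n) := by
  intro x y h
  rcases x with _ | (_ | ⟨s, k⟩) | ⟨s, k⟩ | k <;> rcases y with _ | (_ | ⟨t, l⟩) | ⟨t, l⟩ | l <;>
    simp only [exponents, Prod.mk.injEq] at h <;>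
    (try simp only [Option.some.injEq, Sum.inl.injEq, Sum.inr.injEq, Prod.mk.injEq, Fin.ext_iff,
      reduceCtorEq]) <;>
    obtain ⟨h, h'⟩ := h <;> (try split_ifs at h) <;> omega

theorem ofVertex_injective (hn : 2 ≤ n) : Function.Injective (ofVertex n) := by
  intro x y h
  have key := exponents_eq hn (exponents_fst_lt hn x) (exponents_fst_lt hn y) (exponents_snd_lt x)
    (exponents_snd_lt y) h
  exact exponents_injective hn (Prod.ext key.1 key.2)

theorem exists_exponents_eq (hn : 2 ≤ n) {i s : ℕ} (hi : i < 4 * n) (hs : s < 2) :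
    ∃ x, exponents n x = (i, s) := by
  interval_cases s
  · rcases Nat.lt_trichotomy i (2 * n) with h | rfl | h
    · rcases Nat.eq_zero_or_pos i with rfl | h0
      · exact ⟨none, rfl⟩
      · exact ⟨some (.inl (some (0, ⟨i - 1, by omega⟩))), by simp [exponents]; omega⟩
    · exact ⟨some (.inl none), rfl⟩
    · exact ⟨some (.inl (some (1, ⟨i - 2 * n - 1, by omega⟩))), by simp [exponents]; omega⟩
  · rcases Nat.even_or_odd' i with ⟨k, rfl | rfl⟩
    · exact ⟨some (.inr (.inr ⟨k, by omega⟩)), rfl⟩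
    · by_cases h : k < n
      · exact ⟨some (.inr (.inl (0, ⟨k, h⟩))), by simp [exponents]⟩
      · exact ⟨some (.inr (.inl (1, ⟨k - n, by omega⟩))), by simp [exponents]; omega⟩

theorem ofVertex_surjective (hn : 2 ≤ n) : Function.Surjective (ofVertex n) := by
  intro x
  obtain ⟨i, hi, s, hs, rfl⟩ := exists_eq hn x
  obtain ⟨x, hx⟩ := exists_exponents_eq hn hi hs
  exact ⟨x, by rw [ofVertex, hx]⟩

theorem a_pow_mul_b_mul_self (hn : 2 ≤ n) (i : ℕ) :
    (a n ^ i * b n) * (a n ^ i * b n) = a n ^ (2 * n * i) := by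
  rw [mul_assoc, ← mul_assoc (b n), b_mul_a_pow, mul_assoc, ← pow_two, b_sq, mul_one, ← pow_add]
  congr 1
  obtain ⟨m, rfl⟩ : ∃ m, n = m + 1 := ⟨n - 1, by omega⟩
  rw [show 2 * (m + 1) - 1 = 2 * m + 1 by omega]
  ring

theorem ofVertex_root : ofVertex n none = 1 := by simp [ofVertex, exponents]

theorem ofVertex_hub : ofVertex n (some (.inl none)) = a n ^ (2 * n) := by
  simp [ofVertex, exponents]

theorem ofVertex_leaf_mul_self (hn : 2 ≤ n) (k : Fin (2 * n)) :
    ofVertex n (some (.inr (.inr k))) * ofVertex n (some (.inr (.inr k))) = 1 := by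
  simp only [ofVertex, exponents, pow_one]
  rw [a_pow_mul_b_mul_self hn, show 2 * n * (2 * k.1) = 0 + 4 * n * k by ring, a_pow_add_mul,
    pow_zero]

theorem ofVertex_pair_mul_self (hn : 2 ≤ n) (p : Fin 2 × Fin n) :
    ofVertex n (some (.inr (.inl p))) * ofVertex n (some (.inr (.inl p))) =
      ofVertex n (some (.inl none)) := by
  obtain ⟨s, k⟩ := p
  rw [ofVertex_hub]
  simp only [ofVertex, exponents, pow_one]
  rw [a_pow_mul_b_mul_self hn]
  split_ifs
  · rw [← a_pow_add_mul (2 * n) k]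
    congr 1
    ring
  · rw [← a_pow_add_mul (2 * n) (k + n)]
    congr 1
    ring

theorem ofVertex_hub_mul_self :
    ofVertex n (some (.inl none)) * ofVertex n (some (.inl none)) = 1 := by
  rw [ofVertex_hub, ← pow_add, ← a_pow (n := n)]
  congr 1
  ring

theorem ofVertex_hub_mul_pair (s : Fin 2) (k : Fin n) :
    ofVertex n (some (.inl none)) * ofVertex n (some (.inr (.inl (s, k)))) =
      ofVertex n (some (.inr (.inl (1 - s, k)))) := by
  rw [ofVertex_hub]
  simp only [ofVertex, exponents, pow_one]
  rw [← mul_assoc, ← pow_add]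
  congr 1
  fin_cases s
  · simp [add_comm]
  · simp only [Fin.mk_one, one_ne_zero, if_false, sub_self, if_true]
    rw [← a_pow_add (2 * k + 1 + 0)]
    congr 1
    ring

theorem ofVertex_mem_zpowers_leaf (hn : 2 ≤ n) {x : Vertex n} {k : Fin (2 * n)}
    (h : ofVertex n x ∈ Subgroup.zpowers (ofVertex n (some (.inr (.inr k))))) :
    x = none ∨ x = some (.inr (.inr k)) := by
  have hsq := ofVertex_leaf_mul_self hn k
  set z := ofVertex n (some (.inr (.inr k))) with hz
  obtain ⟨m, hm⟩ := Subgroup.mem_zpowers_iff.1 h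
  rcases Int.even_or_odd' m with ⟨j, rfl | rfl⟩
  · left
    apply ofVertex_injective hn
    rw [ofVertex_root, ← hm, zpow_mul, zpow_two, hsq, one_zpow]
  · right
    apply ofVertex_injective hn
    rw [← hz, ← hm, zpow_add, zpow_mul, zpow_two, hsq, one_zpow, one_mul, zpow_one]

/-- The generator squares to the central involution, so exponents matter only mod 4; the cube is the
other member of the pair. -/
theorem ofVertex_mem_zpowers_pair (hn : 2 ≤ n) {x : Vertex n} {p : Fin 2 × Fin n} :
    ofVertex n x ∈ Subgroup.zpowers (ofVertex n (some (.inr (.inl p)))) ↔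
      x = none ∨ x = some (.inl none) ∨ ∃ s, x = some (.inr (.inl (s, p.2))) := by
  obtain ⟨s, k⟩ := p
  have hsq := ofVertex_pair_mul_self hn (s, k)
  have hmul := ofVertex_hub_mul_pair s k
  constructor
  · intro h
    obtain ⟨m, hm⟩ := Subgroup.mem_zpowers_iff.1 h
    rcases Int.even_or_odd' m with ⟨j, rfl | rfl⟩ <;>
      rcases Int.even_or_odd' j with ⟨l, rfl | rfl⟩
    · left
      apply ofVertex_injective hn
      rw [← hm, zpow_mul, zpow_two, hsq, zpow_mul, zpow_two, ofVertex_hub_mul_self, one_zpow,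
        ofVertex_root]
    · right; left
      apply ofVertex_injective hn
      rw [← hm, zpow_mul, zpow_two, hsq, zpow_add, zpow_mul, zpow_two, ofVertex_hub_mul_self,
        one_zpow, one_mul, zpow_one]
    · right; right
      refine ⟨s, ofVertex_injective hn ?_⟩
      rw [← hm, zpow_add, zpow_mul, zpow_two, hsq, zpow_mul, zpow_two, ofVertex_hub_mul_self,
        one_zpow, one_mul, zpow_one]
    · right; right
      refine ⟨1 - s, ofVertex_injective hn ?_⟩
      rw [← hm, zpow_add, zpow_mul, zpow_two, hsq, zpow_add, zpow_mul, zpow_two,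
        ofVertex_hub_mul_self, one_zpow, one_mul, zpow_one, zpow_one, hmul]
  · have hself := Subgroup.mem_zpowers (ofVertex n (some (.inr (.inl (s, k)))))
    have hhub := mul_mem hself hself
    rw [hsq] at hhub
    rintro (rfl | rfl | ⟨t, rfl⟩)
    · rw [ofVertex_root]; exact one_mem _
    · exact hhub
    · obtain rfl | rfl : t = s ∨ t = 1 - s := by clear hsq hmul hself hhub; decide +revert
      · exact hself
      · rw [← hmul]; exact mul_mem hhub hself

theorem ofVertex_mem_zpowers_a (hn : 2 ≤ n) {x : Vertex n} :
    ofVertex n x ∈ Subgroup.zpowers (a n) ↔ x = none ∨ ∃ y, x = some (.inl y) := by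
  constructor
  · intro h
    have hfin : IsOfFinOrder (a n) := isOfFinOrder_iff_pow_eq_one.2 ⟨4 * n, by omega, a_pow⟩
    obtain ⟨m, hm⟩ := (hfin.mem_powers_iff_mem_zpowers).2 h
    have hm' : a n ^ (m % (4 * n)) * b n ^ 0 = ofVertex n x := by
      rw [a_pow_mod, pow_zero, mul_one]; exact hm
    have key := (exponents_eq hn (Nat.mod_lt _ (by omega)) (exponents_fst_lt hn x) (by omega)
      (exponents_snd_lt x) hm').2
    rcases x with _ | y | p | k
    · exact Or.inl rfl
    · exact Or.inr ⟨y, rfl⟩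
    · exact absurd key (by simp [exponents])
    · exact absurd key (by simp [exponents])
  · rintro (rfl | ⟨y, rfl⟩)
    · rw [ofVertex_root]; exact one_mem _
    · have : (exponents n (some (.inl y))).2 = 0 := by rcases y with _ | ⟨s, k⟩ <;> rfl
      rw [ofVertex, this, pow_zero, mul_one]
      exact Subgroup.npow_mem_zpowers _ _

/-! ### The enhanced power graph as a two-hub graph -/

/-- The correspondence between vertices and elements. -/
noncomputable def vertexEquiv (hn : 2 ≤ n) : Vertex n ≃ SemidihedralGroup n :=
  Equiv.ofBijective (ofVertex n) ⟨ofVertex_injective hn, ofVertex_surjective hn⟩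

theorem comap_adj_iff (hn : 2 ≤ n) (x y : Vertex n) :
    ((enhancedPowerGraph (SemidihedralGroup n)).comap (vertexEquiv hn)).Adj x y ↔ x ≠ y ∧
      ((∃ z, ofVertex n x ∈ Subgroup.zpowers (ofVertex n z) ∧
        ofVertex n y ∈ Subgroup.zpowers (ofVertex n z))) := by
  refine and_congr (vertexEquiv hn).injective.ne_iff ?_
  rw [(ofVertex_surjective hn).exists]
  rfl

theorem zpowers_ofVertex_le (hn : 2 ≤ n) {z : Vertex n} (hz : z = none ∨ ∃ y, z = some (.inl y)) :
    Subgroup.zpowers (ofVertex n z) ≤ Subgroup.zpowers (a n) := by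
  rw [Subgroup.zpowers_le]
  exact (ofVertex_mem_zpowers_a hn).2 hz

/-- The three cases are the three kinds of cyclic subgroup that can contain both ends of an edge. -/
theorem adj_cases (hn : 2 ≤ n) {x y : Vertex n}
    (h : ((enhancedPowerGraph (SemidihedralGroup n)).comap (vertexEquiv hn)).Adj x y) :
    ((x = none ∨ ∃ w, x = some (.inl w)) ∧ (y = none ∨ ∃ w, y = some (.inl w))) ∨
    (∃ k, (x = none ∨ x = some (.inl none) ∨ ∃ s, x = some (.inr (.inl (s, k)))) ∧
      (y = none ∨ y = some (.inl none) ∨ ∃ s, y = some (.inr (.inl (s, k))))) ∨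
    ∃ k, (x = none ∨ x = some (.inr (.inr k))) ∧ (y = none ∨ y = some (.inr (.inr k))) := by
  obtain ⟨-, z, hx, hy⟩ := (comap_adj_iff hn x y).1 h
  have hpow : (z = none ∨ ∃ y, z = some (.inl y)) →
      (x = none ∨ ∃ w, x = some (.inl w)) ∧ (y = none ∨ ∃ w, y = some (.inl w)) := fun hz =>
    ⟨(ofVertex_mem_zpowers_a hn).1 (zpowers_ofVertex_le hn hz hx),
      (ofVertex_mem_zpowers_a hn).1 (zpowers_ofVertex_le hn hz hy)⟩
  rcases z with _ | w | p | k
  · exact Or.inl (hpow (Or.inl rfl))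
  · exact Or.inl (hpow (Or.inr ⟨w, rfl⟩))
  · exact Or.inr (Or.inl ⟨p.2, (ofVertex_mem_zpowers_pair hn).1 hx,
      (ofVertex_mem_zpowers_pair hn).1 hy⟩)
  · exact Or.inr (Or.inr ⟨k, ofVertex_mem_zpowers_leaf hn hx, ofVertex_mem_zpowers_leaf hn hy⟩)

theorem isTwoHubGraph (hn : 2 ≤ n) :
    IsTwoHubGraph ((enhancedPowerGraph (SemidihedralGroup n)).comap (vertexEquiv hn)) where
  root w := by
    refine (comap_adj_iff hn _ _).2 ⟨by simp, some w, Subgroup.mem_zpowers _, ?_⟩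
    rw [ofVertex_root]
    exact one_mem _
  clique x y := by
    refine ⟨fun h hxy => h.ne (by rw [hxy]), fun h => ⟨?_, a n, ?_, ?_⟩⟩
    · exact (vertexEquiv hn).injective.ne (by simpa using h)
    · exact (ofVertex_mem_zpowers_a hn).2 (Or.inr ⟨x, rfl⟩)
    · exact (ofVertex_mem_zpowers_a hn).2 (Or.inr ⟨y, rfl⟩)
  hub x p := by
    constructor
    · intro h
      have hc := adj_cases hn h
      simp at hc
      exact hc.1
    · rintro rfl
      refine (comap_adj_iff hn _ _).2 ⟨by simp, some (.inr (.inl p)), ?_, Subgroup.mem_zpowers _⟩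
      exact (ofVertex_mem_zpowers_pair hn).2 (Or.inr (Or.inl rfl))
  pair p q := by
    obtain ⟨s, k⟩ := p
    obtain ⟨t, l⟩ := q
    constructor
    · intro h
      have hne := h.ne
      have hc := adj_cases hn h
      simp at hc hne
      exact ⟨hc.symm, fun hst => hne hst hc.symm⟩
    · rintro ⟨rfl, hst⟩
      refine (comap_adj_iff hn _ _).2 ⟨by simpa using hst, some (.inr (.inl (s, k))),
        Subgroup.mem_zpowers _, ?_⟩
      exact (ofVertex_mem_zpowers_pair hn).2 (Or.inr (Or.inr ⟨t, rfl⟩))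
  clique_leaf x c h := by simpa using adj_cases hn h
  pair_leaf p c h := by simpa using adj_cases hn h
  leaf_leaf c d h := by
    have hc := adj_cases hn h
    simp at hc
    exact h.ne (by rw [hc])

end SemidihedralGroup

/-! ### The count -/

theorem mainTheorem9 (n : ℕ) (hn : 2 ≤ n) :
    (spanningTrees (enhancedPowerGraph (SemidihedralGroup n))).ncard =
      2 ^ (11 * n - 5) * 3 * n ^ (4 * n - 2) := by
  classical
  have h := (SemidihedralGroup.isTwoHubGraph hn).det_reducedLaplacian
  rw [← ncard_spanningTrees_eq_det, ncard_spanningTrees_comap] at h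
  have hcard : Fintype.card (Fin 2 × Fin (2 * n - 1)) = 4 * n - 2 := by
    simp
    omega
  rw [hcard, Fintype.card_fin] at h
  have h4 : 4 * n - 2 + 2 = 4 * n := by omega
  have h' : (spanningTrees (enhancedPowerGraph (SemidihedralGroup n))).ncard * (4 * n) =
      8 ^ n * (4 * n) ^ (4 * n - 2) * (4 * n + 2 * n) := by
    -- Writing `4 * n` as `4 * n - 2 + 2` keeps the truncated subtraction atomic under the cast to
    -- `ℚ`.
    rw [← h4, Nat.add_sub_cancel]
    exact_mod_cast h
  refine Nat.eq_of_mul_eq_mul_right (show 0 < 4 * n by omega) (h'.trans ?_)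
  obtain ⟨m, rfl⟩ : ∃ m, n = m + 1 := ⟨n - 1, by omega⟩
  rw [show 4 * (m + 1) - 2 = 4 * m + 2 by omega, show 11 * (m + 1) - 5 = 11 * m + 6 by omega,
    show 8 = 2 ^ 3 by norm_num, show 4 * (m + 1) = 2 ^ 2 * (m + 1) by norm_num, mul_pow,
    ← pow_mul, ← pow_mul]
  ring
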